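/- A 2-ball state is a $0/1$ vector $\langle \alpha_1,\alpha_2,\dots\rangle$ with exactly two ones, and there is a transition $\alpha\to\beta$ between two such states if and only if $\alpha_{i+1}\le\beta_i$ for all $i\ge 1$; $\langle 1,1\rangle$ denotes the state with $\alpha_1=\alpha_2=1$. A 2-ball prime pattern of length $n$ is a cycle through $n$ distinct states in the resulting directed graph (a transition from a state to itself is a cycle of length $1$), where cycles that differ only by the choice of the starting state are identified. For $n\ge 1$ let $B(n)$ be the number of 2-ball prime patterns of length $n$ that contain the state $\langle 1,1\rangle$. For integers $t\ge1$ and $m$ put $$c_t(m)=\sum_{\substack{p_1>\cdots>p_t\ge 1\\ p_1+\cdots+p_t=m}}\frac{1}{t(t+1)}\prod_{i=1}^t\Big(\frac{i+1}{i}\Big)^{p_i}$$ (so $c_t(m)=0$ for $m\le 0$), and let $q_1=\tfrac12$, $q_t=\frac{t-1}{2^t-t-1}\,q_{t-1}$ for $t\ge2$. Theorem. (a) For every $n\ge1$, the number $B(n)$ is finite and $$B(n)=\sum_{t\ge0}\ \sum_{\substack{p_1>\cdots>p_t\ge 1\\ p_1+\cdots+p_t=n-t}}\frac1{t+1}\prod_{i=1}^t\Big(\frac{i+1}{i}\Big)^{p_i}+\sum_{t\ge0}\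 \sum_{\substack{p_1>\cdots>p_t\ge 1\\ p_1+\cdots+p_t=n-t-1}}\frac1{t+1}\prod_{i=1}^t\Big(\frac{i+1}{i}\Big)^{p_i},$$ where for $t=0$ the inner sum ranges over the empty tuple, with sum $0$ and empty product $1$. (b) For every $n\ge2$, $$B(n)=\sum_{t=1}^\infty t\,c_t(n-t)+\sum_{t=1}^\infty t\,c_t(n-t-1).$$ (c) The series $\sum_{t\ge1} t q_t/2^t$ converges, and with $$\gamma_B=\frac32\sum_{t=1}^\infty\frac{t\,q_t}{2^t}=\frac34\sum_{t=1}^\infty t\Big(\frac1{2^t}\prod_{i=2}^t\frac{i-1}{2^i-i-1}\Big)$$ one has $B(n)\sim\gamma_B\,2^n$ as $n\to\infty$. -/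

import Mathlib

namespace Juggling

/-- A juggling state `⟨α₁, α₂, …⟩` with `b` balls: a 0/1 vector with exactly `b` ones, recorded by
the finite set of positions of its ones. Positions are counted from `0`: `i ∈ α.ones` means that
`α_{i+1} = 1`, i.e. a ball lands `i + 1` beats from the present. -/
@[ext]
structure State (b : ℕ) where
  ones : Finset ℕ
  card_ones : ones.card = b

/-- The transition `α → β`: `α_{i+1} ≤ β_i` for all `i ≥ 1` (both vectors having `b` ones). -/
def Transition {b : ℕ} (α β : State b) : Prop :=
  ∀ i : ℕ, i + 1 ∈ α.ones → i ∈ β.ones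

/-- The prime `b`-ball juggling patterns of length `n`: cycles in the state graph that visit `n`
distinct states. A `Cycle` is a list up to rotation, so the starting point does not matter. -/
def primePatterns (b n : ℕ) : Set (Cycle (State b)) :=
  {c | c.length = n ∧ c.Nodup ∧ c.Chain Transition}

/-- The base state `⟨1, 1⟩`. -/
def baseState : State 2 := ⟨{0, 1}, rfl⟩

/-- The prime 2-ball patterns of length `n` that contain the state `⟨1, 1⟩`. -/
def basePatterns (n : ℕ) : Set (Cycle (State 2)) :=
  {c | c ∈ primePatterns 2 n ∧ baseState ∈ c}

/-- The number `B(n)` of prime 2-ball patterns of length `n` that contain `⟨1, 1⟩`. -/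
noncomputable def B (n : ℕ) : ℕ := (basePatterns n).ncard

open Classical in
/-- The tuples `p₁ > ⋯ > p_t ≥ 1` with `p₁ + ⋯ + p_t = m`; `p i` is `p_{i+1}`. -/
noncomputable def distinctParts (t : ℕ) (m : ℤ) : Finset (Fin t → ℕ) :=
  (Fintype.piFinset fun _ : Fin t => Finset.Icc 1 m.toNat).filter
    fun p => StrictAnti p ∧ ∑ i, (p i : ℤ) = m

/-- The bounding box in the definition of `distinctParts` loses nothing. -/
theorem mem_distinctParts {t : ℕ} {m : ℤ} {p : Fin t → ℕ} :
    p ∈ distinctParts t m ↔ StrictAnti p ∧ (∀ i, 1 ≤ p i) ∧ ∑ i, (p i : ℤ) = m := by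
  simp only [distinctParts, Finset.mem_filter, Fintype.mem_piFinset, Finset.mem_Icc]
  constructor
  · rintro ⟨h1, h2, h3⟩
    exact ⟨h2, fun i => (h1 i).1, h3⟩
  · rintro ⟨h1, h2, h3⟩
    refine ⟨fun i => ⟨h2 i, ?_⟩, h1, h3⟩
    have h : (p i : ℤ) ≤ ∑ j, (p j : ℤ) :=
      Finset.single_le_sum (f := fun j => (p j : ℤ)) (fun j _ => Int.natCast_nonneg _)
        (Finset.mem_univ i)
    omega

/-- The product `∏_{i=1}^t ((i+1)/i)^{p_i}`. -/
noncomputable def partsWeight {t : ℕ} (p : Fin t → ℕ) : ℝ :=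
  ∏ i : Fin t, (((i : ℕ) + 2 : ℝ) / ((i : ℕ) + 1 : ℝ)) ^ p i

/-- `c_t(m) = ∑ (1 / (t (t+1))) ∏_{i=1}^t ((i+1)/i)^{p_i}`, summed over `p₁ > ⋯ > p_t ≥ 1` with
`p₁ + ⋯ + p_t = m`, for `t ≥ 1`; it is an empty sum for `m ≤ 0`. -/
noncomputable def c (t : ℕ) (m : ℤ) : ℝ :=
  ∑ p ∈ distinctParts t m, 1 / ((t : ℝ) * ((t : ℝ) + 1)) * partsWeight p

/-- `q₁ = 1/2` and `q_t = ((t-1) / (2^t - t - 1)) q_{t-1}` for `t ≥ 2`. The value at `0` is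
not used. -/
noncomputable def q : ℕ → ℝ
  | 0 => 0
  | 1 => 1 / 2
  | t + 2 => ((t : ℝ) + 1) / (2 ^ (t + 2) - ((t : ℝ) + 2) - 1) * q (t + 1)

/-- The constant `γ_B = (3/2) ∑_{t ≥ 1} t q_t / 2^t`. -/
noncomputable def gammaB : ℝ := 3 / 2 * ∑' t : ℕ+, ((t : ℕ) : ℝ) * q t / 2 ^ (t : ℕ)

end Juggling

namespace Juggling

/-! A state is a pair (height of the lower ball, gap between the balls). While the lower ball is in
the air the walk is forced and the gap stays fixed. When it lands, the gap `e` becomes the height of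
the other ball, and the thrown ball lands either after it (any new gap) or before it (a smaller gap,
which is marked). A closed walk through the base state is thus a word of marked gaps returning to
gap 0. Every visit to a gap ends at height 0, so the states are distinct exactly when the gaps are.
The length telescopes: only unmarked gaps `e` count, with `e + 1` each (`length_expand`,
`bijOn_expand`).

Strip the final gap 0 and let A(t, m) be the number of remaining words with t unmarked gaps of sum
m. Sorting them by the role of the smallest possible gap 1 gives A(t+1, m) = (t+2) A(t+1, m-t-1) +
(t+1) A(t, m-t-1) (`encard_arrangements_succ`). Removing 1 from every part yields a matching
recursion for the weighted sum W(t, m) over strictly decreasing tuples (`totalWeight_succ`), whence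
(t+1) A(t, m) = W(t, m). The two sums in the formula for B(n) correspond to a marked and an unmarked
final return to gap 0.

For the asymptotics, c_t(m) / 2^m is increasing in m, and its recursion has q_t as limiting fixed
point (`cRatio_spec`). Dominated convergence gives the limit of B(n) / 2^n, the two sums
contributing factors 1 and 1/2. -/

/-! ### The state graph in terms of heights and gaps. -/

/-- The state whose next ball lands after `l + 1` beats and whose balls land `e + 1` beats apart. -/
def gapState (l e : ℕ) : State 2 :=
  ⟨{l, l + e + 1}, Finset.card_pair (by omega)⟩

theorem gapState_zero_zero : gapState 0 0 = baseState := rfl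

theorem gapState_inj {l e l' e' : ℕ} : gapState l e = gapState l' e' ↔ l = l' ∧ e = e' := by
  constructor
  · intro h
    have h1 : ({l, l + e + 1} : Finset ℕ) = {l', l' + e' + 1} := congrArg State.ones h
    have a1 : l ∈ ({l', l' + e' + 1} : Finset ℕ) := by rw [← h1]; simp
    have a2 : l + e + 1 ∈ ({l', l' + e' + 1} : Finset ℕ) := by rw [← h1]; simp
    have a3 : l' ∈ ({l, l + e + 1} : Finset ℕ) := by rw [h1]; simp
    simp only [Finset.mem_insert, Finset.mem_singleton] at a1 a2 a3
    omega
  · rintro ⟨rfl, rfl⟩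
    rfl

theorem exists_eq_gapState (s : State 2) : ∃ l e, s = gapState l e := by
  obtain ⟨a, b, hab, h⟩ := Finset.card_eq_two.1 s.card_ones
  rcases lt_or_gt_of_ne hab with h1 | h1
  · refine ⟨a, b - a - 1, State.ext ?_⟩
    rw [h]
    simp only [gapState]
    congr 2
    omega
  · refine ⟨b, a - b - 1, State.ext ?_⟩
    rw [h, Finset.pair_comm]
    simp only [gapState]
    congr 2
    omega

theorem transition_gapState_succ {l e l' e' : ℕ} :
    Transition (gapState (l + 1) e) (gapState l' e') ↔ l' = l ∧ e' = e := by
  simp only [Transition, gapState, Finset.mem_insert, Finset.mem_singleton]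
  constructor
  · intro h
    have h1 := h l (by omega)
    have h2 := h (l + e + 1) (by omega)
    omega
  · rintro ⟨rfl, rfl⟩ i hi
    omega

/-- After the throw the other ball sits at height `e`. It is the lower ball of the new state in the
first alternative and the higher one in the second. -/
theorem transition_gapState_zero {e l' e' : ℕ} :
    Transition (gapState 0 e) (gapState l' e') ↔ l' = e ∨ l' + e' + 1 = e := by
  simp only [Transition, gapState, Finset.mem_insert, Finset.mem_singleton]
  constructor
  · intro h
    have h1 := h e (by omega)
    omega
  · rintro h i hi
    omega

/-- The states passed while the lower ball of `gapState l e` comes down. -/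
def descent : ℕ → ℕ → List (State 2)
  | 0, e => [gapState 0 e]
  | l + 1, e => gapState (l + 1) e :: descent l e

theorem length_descent (l e : ℕ) : (descent l e).length = l + 1 := by
  induction l with
  | zero => rfl
  | succ l ih => simp [descent, ih]

theorem mem_descent {l e : ℕ} {s : State 2} : s ∈ descent l e ↔ ∃ j ≤ l, s = gapState j e := by
  induction l with
  | zero => simp [descent]
  | succ l ih =>
    simp only [descent, List.mem_cons, ih]
    constructor
    · rintro (rfl | ⟨j, hj, rfl⟩)
      · exact ⟨_, le_rfl, rfl⟩
      · exact ⟨j, by omega, rfl⟩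
    · rintro ⟨j, hj, rfl⟩
      rcases Nat.lt_or_ge l j with h | h
      · left
        rw [show j = l + 1 by omega]
      · exact Or.inr ⟨j, h, rfl⟩

theorem nodup_descent (l e : ℕ) : (descent l e).Nodup := by
  induction l with
  | zero => simp [descent]
  | succ l ih =>
    rw [descent, List.nodup_cons]
    refine ⟨fun h => ?_, ih⟩
    obtain ⟨j, hj, h⟩ := mem_descent.1 h
    have := (gapState_inj.1 h).1
    omega

theorem isChain_descent_append {l e : ℕ} {L : List (State 2)}
    (h : List.IsChain Transition (gapState 0 e :: L)) :
    List.IsChain Transition (descent l e ++ L) := by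
  induction l with
  | zero => exact h
  | succ l ih =>
    rw [descent, List.cons_append, List.isChain_cons]
    refine ⟨?_, ih⟩
    cases l <;> simp [descent, transition_gapState_succ]

theorem head?_descent_append (l e : ℕ) (L : List (State 2)) :
    (descent l e ++ L).head? = some (gapState l e) := by
  cases l <;> rfl

theorem getLast?_descent_append (l e : ℕ) (L : List (State 2)) :
    (descent l e ++ L).getLast? = (gapState 0 e :: L).getLast? := by
  induction l with
  | zero => rfl
  | succ l ih =>
    rw [descent, List.cons_append, List.getLast?_cons, ih]
    simp [List.getLast?_cons]

/-! ### Walks encoded by words of marked gaps. -/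

/-- A marked gap is smaller than the gap before it. -/
def MarkDescends (x y : ℕ × Bool) : Prop := y.2 = true → y.1 < x.1

/-- The height at which the gap `y.1` is entered when a throw is made from the gap `e`: the thrown
ball lands first if `y` is marked, and last otherwise. -/
def entryHeight (e : ℕ) (y : ℕ × Bool) : ℕ := if y.2 then e - y.1 - 1 else e

/-- The states visited after `gapState 0 e` when the throws lead through the given gaps. -/
def expand : ℕ → List (ℕ × Bool) → List (State 2)
  | _, [] => []
  | e, y :: w => descent (entryHeight e y) y.1 ++ expand y.1 w

theorem isChain_expand {x : ℕ × Bool} {w : List (ℕ × Bool)}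
    (h : List.IsChain MarkDescends (x :: w)) :
    List.IsChain Transition (gapState 0 x.1 :: expand x.1 w) := by
  induction w generalizing x with
  | nil => simp [expand]
  | cons y w ih =>
    rw [List.isChain_cons_cons] at h
    rw [expand, List.isChain_cons]
    refine ⟨?_, isChain_descent_append (ih h.2)⟩
    rw [head?_descent_append]
    simp only [Option.mem_def, Option.some.injEq, forall_eq', transition_gapState_zero, entryHeight]
    split_ifs with hy
    · have := h.1 hy
      omega
    · exact Or.inl rfl

theorem exists_mem_of_mem_expand {e : ℕ} {w : List (ℕ × Bool)} {s : State 2}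
    (h : s ∈ expand e w) : ∃ l, ∃ f ∈ w.map Prod.fst, s = gapState l f := by
  induction w generalizing e with
  | nil => simp [expand] at h
  | cons y w ih =>
    rw [expand, List.mem_append] at h
    rcases h with h | h
    · obtain ⟨j, -, rfl⟩ := mem_descent.1 h
      exact ⟨j, y.1, by simp, rfl⟩
    · obtain ⟨l, f, hf, rfl⟩ := ih h
      exact ⟨l, f, by rw [List.map_cons]; exact List.mem_cons_of_mem _ hf, rfl⟩

theorem nodup_expand {e : ℕ} {w : List (ℕ × Bool)} (h : (w.map Prod.fst).Nodup) :
    (expand e w).Nodup := by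
  induction w generalizing e with
  | nil => simp [expand]
  | cons y w ih =>
    rw [List.map_cons, List.nodup_cons] at h
    rw [expand, List.nodup_append]
    refine ⟨nodup_descent _ _, ih h.2, ?_⟩
    rintro a ha b hb rfl
    obtain ⟨j, -, rfl⟩ := mem_descent.1 ha
    obtain ⟨l, f, hf, hh⟩ := exists_mem_of_mem_expand hb
    rw [(gapState_inj.1 hh).2] at h
    exact h.1 hf

/-- Each descent ends at height 0, so a walk without repeated states has no repeated gaps. -/
theorem sublist_expand (e : ℕ) (w : List (ℕ × Bool)) :
    ((w.map Prod.fst).map (gapState 0)).Sublist (expand e w) := by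
  induction w generalizing e with
  | nil => simp [expand]
  | cons y w ih =>
    rw [expand, List.map_cons, List.map_cons, ← List.singleton_append]
    refine List.Sublist.append ?_ (ih _)
    rw [List.singleton_sublist, mem_descent]
    exact ⟨0, Nat.zero_le _, rfl⟩

theorem getLast?_expand (e : ℕ) (w : List (ℕ × Bool)) :
    (gapState 0 e :: expand e w).getLast? =
      some (gapState 0 ((e :: w.map Prod.fst).getLast (List.cons_ne_nil _ _))) := by
  induction w generalizing e with
  | nil => simp [expand]
  | cons y w ih =>
    have h := getLast?_descent_append (entryHeight e y) y.1 (expand y.1 w)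
    rw [ih] at h
    rw [expand, List.getLast?_cons, h]
    simp

/-- Passing from gap `e` to gap `f` takes `e + 1 = (f + 1) + (e - f)` states if `f` is unmarked and
`e - f` if it is marked. The differences `e - f` telescope. -/
theorem length_expand {x : ℕ × Bool} {w : List (ℕ × Bool)}
    (h : List.IsChain MarkDescends (x :: w)) :
    (expand x.1 w).length + (x.1 :: w.map Prod.fst).getLast (List.cons_ne_nil _ _) =
      x.1 + (w.map fun y => (if y.2 then 0 else y.1 + 1 : ℕ)).sum := by
  induction w generalizing x with
  | nil => simp [expand]
  | cons y w ih =>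
    rw [List.isChain_cons_cons] at h
    have h1 := ih h.2
    simp only [expand, List.length_append, length_descent, List.map_cons, List.sum_cons,
      List.getLast_cons_cons, entryHeight]
    split_ifs with hy
    · have := h.1 hy
      omega
    · linarith

/-- The first state of a descent reveals the mark: an unmarked gap is entered at height `e`, a
marked one strictly below `e`. -/
theorem expand_injective {x : ℕ × Bool} {w w' : List (ℕ × Bool)}
    (h : List.IsChain MarkDescends (x :: w)) (h' : List.IsChain MarkDescends (x :: w'))
    (heq : expand x.1 w = expand x.1 w') : w = w' := by
  have key : ∀ (e : ℕ) (y : ℕ × Bool) (w : List (ℕ × Bool)),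
      (expand e (y :: w)).head? = some (gapState (entryHeight e y) y.1) :=
    fun e y w => head?_descent_append _ _ _
  induction w generalizing x w' with
  | nil =>
    cases w' with
    | nil => rfl
    | cons y' w' =>
      have := key x.1 y' w'
      rw [← heq] at this
      simp [expand] at this
  | cons y w ih =>
    cases w' with
    | nil =>
      have := key x.1 y w
      rw [heq] at this
      simp [expand] at this
    | cons y' w' =>
      rw [List.isChain_cons_cons] at h h'
      have h2 := key x.1 y w
      rw [heq, key, Option.some_inj, gapState_inj] at h2
      have hy : y = y' := by
        refine Prod.ext h2.2.symm ?_
        have h3 := h2.1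
        have h4 := h.1
        have h5 := h'.1
        simp only [MarkDescends] at h4 h5
        rcases hb : y.2 <;> rcases hb' : y'.2 <;>
          simp only [entryHeight, hb, hb'] at h3 h4 h5 <;> simp at h3 h4 h5 <;> first | rfl | omega
      subst hy
      rw [expand, expand] at heq
      rw [ih h.2 h'.2 (List.append_cancel_left heq)]

/-- Ending at height 0 guarantees that the last descent is complete. The mark `b` is arbitrary
because `MarkDescends` ignores the mark of its first argument. -/
theorem exists_expand_eq {l e : ℕ} {L : List (State 2)}
    (h : List.IsChain Transition (gapState l e :: L))
    (hlast : ∃ f, (gapState l e :: L).getLast? = some (gapState 0 f)) (b : Bool) :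
    ∃ w, List.IsChain MarkDescends ((e, b) :: w) ∧
      gapState l e :: L = descent l e ++ expand e w := by
  induction L generalizing l e b with
  | nil =>
    obtain ⟨f, hf⟩ := hlast
    simp only [List.getLast?_singleton, Option.some_inj, gapState_inj] at hf
    obtain ⟨rfl, rfl⟩ := hf
    exact ⟨[], by simp, by simp [descent, expand]⟩
  | cons s L ih =>
    obtain ⟨l', e', rfl⟩ := exists_eq_gapState s
    rw [List.isChain_cons_cons] at h
    have hlast' : ∃ f, (gapState l' e' :: L).getLast? = some (gapState 0 f) := by
      obtain ⟨f, hf⟩ := hlast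
      exact ⟨f, by simpa [List.getLast?_cons] using hf⟩
    cases l with
    | succ l =>
      obtain ⟨rfl, rfl⟩ := transition_gapState_succ.1 h.1
      obtain ⟨w, hw, hw'⟩ := ih h.2 hlast' b
      exact ⟨w, hw, by rw [hw']; rfl⟩
    | zero =>
      rcases transition_gapState_zero.1 h.1 with hl | hl
      · obtain ⟨w, hw, hw'⟩ := ih h.2 hlast' false
        refine ⟨(e', false) :: w, ?_, ?_⟩
        · rw [List.isChain_cons_cons]
          exact ⟨by simp [MarkDescends], hw⟩
        · rw [hw', hl]
          rfl
      · obtain ⟨w, hw, hw'⟩ := ih h.2 hlast' true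
        refine ⟨(e', true) :: w, ?_, ?_⟩
        · rw [List.isChain_cons_cons]
          exact ⟨fun _ => by show e' < e; omega, hw⟩
        · rw [hw', show l' = e - e' - 1 by omega]
          rfl

/-! ### Prime patterns through the base state correspond to codes. -/

/-- The codes of the prime patterns of length `n` through the base state: the gaps that follow the
throw from the base state, up to and including the return to it. -/
def codes (n : ℕ) : Set (List (ℕ × Bool)) :=
  {w | List.IsChain MarkDescends ((0, false) :: w) ∧ (w.map Prod.fst).Nodup ∧
    (∃ v b, w = v ++ [(0, b)]) ∧ (expand 0 w).length = n}

/-- Without repetitions, only the trivial rotation keeps `a` in front. -/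
theorem eq_of_isRotated_cons {α : Type*} {a : α} {l l' : List α} (hl : (a :: l).Nodup)
    (h : (a :: l) ~r (a :: l')) : l = l' := by
  obtain ⟨k, hk⟩ := h
  have h0 : (a :: l).rotate k = (a :: l').rotate 0 := by simpa using hk
  have hlen : k % (a :: l).length < (a :: l).length := Nat.mod_lt _ (by simp)
  have h1 : ((a :: l).rotate k).head? = some a := by rw [hk]; rfl
  rw [← List.rotate_mod, List.head?_rotate hlen] at h1
  have h2 : (a :: l)[k % (a :: l).length]? = (a :: l)[0]? := by rw [h1]; rfl
  have h3 := (List.getElem?_inj hlen hl).1 h2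
  rw [← List.rotate_mod, h3, List.rotate_zero] at hk
  exact (List.cons.inj hk).2

theorem exists_expand_eq_append {w v : List (ℕ × Bool)} {b : Bool} (hw : w = v ++ [(0, b)]) :
    ∃ L, expand 0 w = L ++ [baseState] := by
  have h := getLast?_expand 0 w
  have h1 : (0 :: w.map Prod.fst).getLast (List.cons_ne_nil _ _) = 0 := by
    subst hw
    simp
  rw [h1] at h
  have h2 : expand 0 w ≠ [] := by
    intro h0
    have := (sublist_expand 0 w).length_le
    rw [h0, hw] at this
    simp at this
  refine ⟨(expand 0 w).dropLast, ?_⟩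
  rw [← List.dropLast_append_getLast h2]
  simp only [List.dropLast_concat]
  congr 2
  rw [List.getLast?_eq_some_getLast (List.cons_ne_nil _ _), List.getLast_cons h2,
    Option.some_inj] at h
  exact h

/-- The base state occurs once in a prime pattern, so cutting the cycle there picks a canonical
rotation. In the expansion of a code it stands last; the throw from it starts the code. -/
theorem bijOn_expand (n : ℕ) :
    Set.BijOn (fun w => (expand 0 w : Cycle (State 2))) (codes n) (basePatterns n) := by
  refine ⟨?_, ?_, ?_⟩
  · rintro w ⟨h1, h2, ⟨v, b, h3⟩, h4⟩
    obtain ⟨L, hL⟩ := exists_expand_eq_append h3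
    have hc := isChain_expand h1
    refine ⟨⟨?_, ?_, ?_⟩, ?_⟩
    · simpa using h4
    · simpa using nodup_expand h2
    · have : ((expand 0 w : List (State 2)) : Cycle (State 2)) = ((baseState :: L : List _)) := by
        rw [hL]
        exact Cycle.coe_eq_coe.2 List.IsRotated.cons_append_singleton.symm
      simp only [this, Cycle.chain_coe_cons]
      rw [← hL]
      exact hc
    · simp only [Cycle.mem_coe_iff, hL]
      simp
  · rintro w ⟨h1, h2, ⟨v, b, h3⟩, h4⟩ w' ⟨h1', h2', ⟨v', b', h3'⟩, h4'⟩ heq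
    obtain ⟨L, hL⟩ := exists_expand_eq_append h3
    obtain ⟨L', hL'⟩ := exists_expand_eq_append h3'
    refine expand_injective h1 h1' ?_
    have hnd := nodup_expand (e := 0) h2
    have hr : (expand 0 w) ~r (expand 0 w') := Cycle.coe_eq_coe.1 heq
    rw [hL, hL'] at hr
    rw [hL] at hnd
    have hr2 : (baseState :: L) ~r (baseState :: L') :=
      (List.IsRotated.cons_append_singleton.trans hr).trans
        List.IsRotated.cons_append_singleton.symm
    have := eq_of_isRotated_cons
      (List.IsRotated.cons_append_singleton.nodup_iff.2 hnd) hr2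
    simp only [hL, hL', this]
  · rintro c ⟨⟨h1, h2, h3⟩, h4⟩
    induction c using Cycle.induction_on with
    | nil => simp at h4
    | cons a l _ =>
      rw [Cycle.mem_coe_iff] at h4
      obtain ⟨s, t, hst⟩ := List.append_of_mem h4
      have hcyc : ((a :: l : List (State 2)) : Cycle (State 2)) =
          ((baseState :: (t ++ s) : List (State 2))) := by
        rw [hst]
        exact Cycle.coe_eq_coe.2 List.isRotated_append
      rw [hcyc] at h1 h2 h3 ⊢
      rw [Cycle.chain_coe_cons] at h3
      -- The chain condition of the cycle repeats the base state at the end, so this closed walk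
      -- starts and ends at height 0.
      obtain ⟨w, hw, hw'⟩ := exists_expand_eq (l := 0) (e := 0) (b := false) h3
        ⟨0, by rw [gapState_zero_zero]; simp [List.getLast?_cons]⟩
      have hw2 : t ++ s ++ [baseState] = expand 0 w := by
        simpa [descent] using hw'
      have hrot : (baseState :: (t ++ s)) ~r (t ++ s ++ [baseState]) :=
        List.IsRotated.cons_append_singleton
      refine ⟨w, ⟨hw, ?_, ?_, ?_⟩, ?_⟩
      · have hnd : (expand 0 w).Nodup := by
          rw [← hw2]
          exact hrot.nodup_iff.1 (by simpa using h2)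
        exact ((sublist_expand 0 w).nodup hnd).of_map _
      · have hlast := getLast?_expand 0 w
        rw [← hw2] at hlast
        have hne : w ≠ [] := by
          rintro rfl
          simp [expand] at hw2
        refine ⟨w.dropLast, (w.getLast hne).2, ?_⟩
        conv_lhs => rw [← List.dropLast_append_getLast hne]
        congr 2
        refine Prod.ext ?_ rfl
        rw [← gapState_zero_zero] at hlast
        rw [← List.cons_append, List.getLast?_concat, Option.some_inj, gapState_inj] at hlast
        have h5 := hlast.2
        rw [List.getLast_cons (by simpa using hne), List.getLast_map] at h5
        exact h5.symm
      · rw [← hw2, ← hrot.perm.length_eq]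
        simpa using h1
      · simp only [← hw2]
        exact Cycle.coe_eq_coe.2 hrot.symm

/-! ### Counting arrangements by the role of the gap 1. -/

/-- The list does not begin with a marked gap. -/
def FreeHead (v : List (ℕ × Bool)) : Prop := ∀ y ∈ v.head?, y.2 = false

/-- The number of unmarked gaps. -/
def freeCount (v : List (ℕ × Bool)) : ℕ := v.countP fun y => !y.2

/-- The sum of the unmarked gaps. -/
def freeSum (v : List (ℕ × Bool)) : ℕ := (v.map fun y => (if y.2 then 0 else y.1 : ℕ)).sum

theorem freeCount_append (a c : List (ℕ × Bool)) :
    freeCount (a ++ c) = freeCount a + freeCount c :=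
  List.countP_append

theorem freeCount_cons (x : ℕ × Bool) (c : List (ℕ × Bool)) :
    freeCount (x :: c) = (if x.2 then 0 else 1) + freeCount c := by
  rcases x with ⟨e, b⟩
  cases b <;> simp [freeCount, Nat.add_comm]

theorem freeSum_append (a c : List (ℕ × Bool)) : freeSum (a ++ c) = freeSum a + freeSum c := by
  simp [freeSum]

theorem freeSum_cons (x : ℕ × Bool) (c : List (ℕ × Bool)) :
    freeSum (x :: c) = (if x.2 then 0 else x.1) + freeSum c := by
  simp [freeSum]

/-- The arrangements of distinct gaps larger than `k`, with `t` unmarked gaps of sum `n`. -/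
def arrangements (k t : ℕ) (n : ℤ) : Set (List (ℕ × Bool)) :=
  {v | (List.IsChain MarkDescends v ∧ FreeHead v) ∧ ((v.map Prod.fst).Nodup ∧ ∀ y ∈ v, k < y.1) ∧
    freeCount v = t ∧ (freeSum v : ℤ) = n}

theorem freeCount_pos {a c : List (ℕ × Bool)} (h : FreeHead (a ++ c)) (ha : a ≠ []) :
    0 < freeCount a := by
  obtain ⟨y, a, rfl⟩ := List.exists_cons_of_ne_nil ha
  have : y.2 = false := h y (by simp)
  simp [freeCount_cons, this]

theorem arrangements_zero (k : ℕ) (n : ℤ) :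
    arrangements k 0 n = if n = 0 then {[]} else ∅ := by
  ext v
  have key : v ∈ arrangements k 0 n ↔ v = [] ∧ n = 0 := by
    constructor
    · rintro ⟨⟨-, h2⟩, -, h3, h4⟩
      have hv : v = [] := by
        by_contra hv
        have := freeCount_pos (c := []) (by simpa using h2) hv
        omega
      subst hv
      exact ⟨rfl, by simpa [freeSum] using h4.symm⟩
    · rintro ⟨rfl, rfl⟩
      simp [arrangements, FreeHead, freeCount, freeSum]
  rw [key]
  split_ifs with h <;> simp [h]

/-- Lower every gap by one. The order conditions are translation invariant, and only the `t`
unmarked gaps enter the sum. -/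
theorem encard_arrangements_one (t : ℕ) (n : ℤ) :
    (arrangements 1 t n).encard = (arrangements 0 t (n - t)).encard := by
  let up : ℕ × Bool → ℕ × Bool := fun y => (y.1 + 1, y.2)
  have hinj : Function.Injective up := by
    rintro ⟨a, b⟩ ⟨c, d⟩ h
    simpa [up] using h
  have hchain : ∀ v : List (ℕ × Bool),
      List.IsChain MarkDescends (v.map up) ↔ List.IsChain MarkDescends v := by
    intro v
    rw [List.isChain_map]
    have : (fun a b => MarkDescends (up a) (up b)) = MarkDescends := by
      funext a b
      simp [MarkDescends, up]
    rw [this]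
  have hhead : ∀ v : List (ℕ × Bool), FreeHead (v.map up) ↔ FreeHead v := by
    intro v
    cases v <;> simp [FreeHead, up]
  have hnd : ∀ v : List (ℕ × Bool), ((v.map up).map Prod.fst).Nodup ↔ (v.map Prod.fst).Nodup := by
    intro v
    rw [List.map_map, show Prod.fst ∘ up = Nat.succ ∘ Prod.fst from rfl, ← List.map_map,
      List.nodup_map_iff Nat.succ_injective]
  have hcount : ∀ v : List (ℕ × Bool), freeCount (v.map up) = freeCount v := by
    intro v
    simp [freeCount, List.countP_map, up, Function.comp_def]
  have hsum : ∀ v : List (ℕ × Bool), freeSum (v.map up) = freeSum v + freeCount v := by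
    intro v
    induction v with
    | nil => rfl
    | cons y v ih =>
      rw [List.map_cons, freeSum_cons, freeSum_cons, freeCount_cons, ih]
      simp only [up]
      split_ifs <;> omega
  rw [← hinj.list_map.encard_image (arrangements 0 t (n - t))]
  congr 1
  ext v
  constructor
  · intro hmem
    obtain ⟨⟨h1, h2⟩, ⟨h3, h4⟩, h5, h6⟩ := hmem
    have hv : (v.map fun y => (y.1 - 1, y.2)).map up = v := by
      rw [List.map_map]
      conv_rhs => rw [← List.map_id v]
      refine List.map_congr_left fun y hy => ?_
      have := h4 y hy
      refine Prod.ext ?_ rfl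
      show y.1 - 1 + 1 = y.1
      omega
    refine ⟨_, ?_, hv⟩
    rw [← hv] at h1 h2 h3 h5 h6
    rw [hchain] at h1
    rw [hhead] at h2
    rw [hnd] at h3
    rw [hcount] at h5
    rw [hsum] at h6
    refine ⟨⟨h1, h2⟩, ⟨h3, ?_⟩, h5, ?_⟩
    · intro y hy
      obtain ⟨z, hz, rfl⟩ := List.mem_map.1 hy
      have := h4 z hz
      show 0 < z.1 - 1
      omega
    · omega
  · rintro ⟨v, ⟨⟨h1, h2⟩, ⟨h3, h4⟩, h5, h6⟩, rfl⟩
    refine ⟨⟨(hchain v).2 h1, (hhead v).2 h2⟩, ⟨(hnd v).2 h3, ?_⟩, by rw [hcount, h5], ?_⟩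
    · intro y hy
      obtain ⟨z, hz, rfl⟩ := List.mem_map.1 hy
      have := h4 z hz
      show 1 < z.1 + 1
      omega
    · rw [hsum]
      push_cast
      omega

/-- The pairs of lists between which the gap `1`, marked according to `b`, can be inserted. -/
def splittings (b : Bool) (t : ℕ) (n : ℤ) : Set (List (ℕ × Bool) × List (ℕ × Bool)) :=
  {p | p.1 ++ p.2 ∈ arrangements 1 t n ∧ FreeHead p.2 ∧ (b = true → p.1 ≠ [])}

theorem exists_splitting (v : List (ℕ × Bool)) {j : ℕ} (hj : j ≤ freeCount v) :
    ∃ a c, v = a ++ c ∧ freeCount a = j ∧ FreeHead c := by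
  induction v generalizing j with
  | nil =>
    refine ⟨[], [], rfl, ?_, by simp [FreeHead]⟩
    simp only [freeCount, List.countP_nil] at hj ⊢
    omega
  | cons y v ih =>
    rw [freeCount_cons] at hj
    rcases hy : y.2 with _ | _
    · rcases j with _ | j
      · exact ⟨[], y :: v, rfl, rfl, by simpa [FreeHead] using hy⟩
      · obtain ⟨a, c, rfl, ha, hc⟩ := ih (j := j) (by simp only [hy] at hj; simp at hj; omega)
        refine ⟨y :: a, c, rfl, ?_, hc⟩
        rw [freeCount_cons, ha]
        simp [hy, Nat.add_comm]
    · obtain ⟨a, c, rfl, ha, hc⟩ := ih (j := j) (by simpa [hy] using hj)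
      refine ⟨y :: a, c, rfl, ?_, hc⟩
      rw [freeCount_cons, ha]
      simp [hy]

/-- An arrangement falls into blocks, an unmarked gap followed by a run of marked ones. A cut
between blocks is determined by the number of unmarked gaps to its left. -/
theorem eq_of_append_eq_append {a c a' c' : List (ℕ × Bool)} (h : a ++ c = a' ++ c')
    (hcount : freeCount a = freeCount a') (hc : FreeHead c) (hc' : FreeHead c') :
    a = a' ∧ c = c' := by
  rcases List.append_eq_append_iff.1 h with ⟨r, rfl, rfl⟩ | ⟨r, rfl, rfl⟩
  · have : r = [] := by
      by_contra hr
      have := freeCount_pos hc hr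
      rw [freeCount_append] at hcount
      omega
    subst this
    simp
  · have : r = [] := by
      by_contra hr
      have := freeCount_pos hc' hr
      rw [freeCount_append] at hcount
      omega
    subst this
    simp

/-- The `t` blocks leave `t + 1` places to cut; the place in front of all of them is forbidden to a
marked gap. -/
theorem encard_splittings (b : Bool) (t : ℕ) (n : ℤ) :
    (splittings b t n).encard =
      (t + (if b then 0 else 1) : ℕ) * (arrangements 1 t n).encard := by
  have hinj : Set.InjOn (fun p : List (ℕ × Bool) × List (ℕ × Bool) =>
      (freeCount p.1, p.1 ++ p.2)) (splittings b t n) := by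
    rintro ⟨a, c⟩ ⟨-, hc, -⟩ ⟨a', c'⟩ ⟨-, hc', -⟩ h
    rw [Prod.mk.injEq] at h
    obtain ⟨rfl, rfl⟩ := eq_of_append_eq_append h.2 h.1 hc hc'
    rfl
  have himage : (fun p : List (ℕ × Bool) × List (ℕ × Bool) => (freeCount p.1, p.1 ++ p.2)) ''
      splittings b t n =
        ((Finset.Icc (if b then 1 else 0) t : Finset ℕ) : Set ℕ) ×ˢ arrangements 1 t n := by
    ext ⟨j, v⟩
    simp only [Set.mem_image, Prod.mk.injEq, Prod.exists, Set.mem_prod, Finset.coe_Icc, Set.mem_Icc]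
    constructor
    · rintro ⟨a, c, ⟨h1, h2, h3⟩, rfl, rfl⟩
      refine ⟨⟨?_, ?_⟩, h1⟩
      · split_ifs with hb
        · exact freeCount_pos h1.1.2 (h3 hb)
        · exact Nat.zero_le _
      · rw [← h1.2.2.1, freeCount_append]
        exact Nat.le_add_right _ _
    · rintro ⟨⟨h1, h2⟩, h3⟩
      obtain ⟨a, c, rfl, ha, hc⟩ := exists_splitting v (j := j) (h3.2.2.1 ▸ h2)
      refine ⟨a, c, ⟨h3, hc, ?_⟩, ha, rfl⟩
      rintro rfl rfl
      simp only [freeCount, List.countP_nil] at ha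
      simp only [if_true] at h1
      omega
  rw [← hinj.encard_image, himage, Set.encard_prod, Set.encard_coe_eq_coe_finsetCard,
    Nat.card_Icc]
  congr 2
  split_ifs <;> omega

/-- Delete the gap 1. As the smallest gap it can carry a mark after any other gap, but no marked gap
can follow it; hence it sits at the end of a block or, if unmarked, in front of everything. -/
theorem encard_arrangements_one_mem (b : Bool) (t : ℕ) (n : ℤ) :
    {v ∈ arrangements 0 (t + if b then 0 else 1) (n + if b then 0 else 1) | (1, b) ∈ v}.encard =
      (splittings b t n).encard := by
  have hinj : Set.InjOn (fun p : List (ℕ × Bool) × List (ℕ × Bool) => p.1 ++ (1, b) :: p.2)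
      (splittings b t n) := by
    rintro ⟨a, c⟩ ⟨h, -, -⟩ ⟨a', c'⟩ ⟨h', -, -⟩ heq
    have hmem : ∀ {a c : List (ℕ × Bool)}, a ++ c ∈ arrangements 1 t n → (1, b) ∉ a := by
      intro a c h hm
      have : 1 < 1 := h.2.1.2 (1, b) (List.mem_append_left _ hm)
      omega
    -- If the two positions differed, the longer prefix would contain the inserted gap 1, although
    -- all its gaps exceed 1.
    rcases List.append_eq_append_iff.1 heq with ⟨r, h1, h2⟩ | ⟨r, h1, h2⟩
    · rcases r with _ | ⟨y, r⟩
      · simp at h1 h2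
        simp [h1, h2]
      · rw [List.cons_append, List.cons.injEq] at h2
        refine absurd ?_ (hmem h')
        dsimp only at h1
        rw [h1, h2.1]
        simp
    · rcases r with _ | ⟨y, r⟩
      · simp at h1 h2
        simp [h1, h2]
      · rw [List.cons_append, List.cons.injEq] at h2
        refine absurd ?_ (hmem h)
        dsimp only at h1
        rw [h1, h2.1]
        simp
  rw [← hinj.encard_image]
  congr 1
  ext u
  simp only [Set.mem_sep_iff, Set.mem_image, Prod.exists]
  have hnd : ∀ a c : List (ℕ × Bool), ((a ++ (1, b) :: c).map Prod.fst).Nodup ↔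
      ((a ++ c).map Prod.fst).Nodup ∧ ∀ y ∈ a ++ c, y.1 ≠ 1 := by
    intro a c
    rw [(List.perm_middle.map Prod.fst).nodup_iff, List.map_cons, List.nodup_cons, and_comm]
    refine and_congr_right fun _ => ?_
    rw [List.mem_map]
    push Not
    rfl
  have hcount : ∀ a c : List (ℕ × Bool), freeCount (a ++ (1, b) :: c) =
      freeCount (a ++ c) + if b then 0 else 1 := by
    intro a c
    rw [freeCount_append, freeCount_append, freeCount_cons]
    dsimp only
    omega
  have hsum : ∀ a c : List (ℕ × Bool), freeSum (a ++ (1, b) :: c) =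
      freeSum (a ++ c) + if b then 0 else 1 := by
    intro a c
    rw [freeSum_append, freeSum_append, freeSum_cons]
    dsimp only
    omega
  constructor
  · rintro ⟨⟨⟨h1, h2⟩, ⟨h3, h4⟩, h5, h6⟩, h7⟩
    obtain ⟨a, c, rfl⟩ := List.append_of_mem h7
    rw [hnd] at h3
    rw [hcount] at h5
    rw [hsum] at h6
    rw [List.isChain_append, List.isChain_cons] at h1
    obtain ⟨ha, ⟨hxc, hc⟩, hax⟩ := h1
    have hfc : FreeHead c := by
      intro y hy
      by_contra hb
      have h8 : y.1 < 1 := hxc y hy (by simpa using hb)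
      have h9 := h4 y (by
        have := List.mem_of_mem_head? hy
        simp [this])
      omega
    push_cast at h6
    refine ⟨a, c, ⟨⟨⟨?_, ?_⟩, ⟨h3.1, ?_⟩, add_right_cancel h5, add_right_cancel h6⟩, hfc, ?_⟩, rfl⟩
    · rw [List.isChain_append]
      refine ⟨ha, hc, fun x _ y hy hb => ?_⟩
      rw [hfc y hy] at hb
      simp at hb
    · rcases a with _ | ⟨x, a⟩
      · exact hfc
      · exact h2
    · intro y hy
      have h8 := h3.2 y hy
      have h9 := h4 y (by
        rw [List.mem_append] at hy
        simp only [List.mem_append, List.mem_cons]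
        tauto)
      omega
    · rintro rfl rfl
      have := h2 (1, true) (by simp)
      simp at this
  · rintro ⟨a, c, ⟨⟨⟨h1, h2⟩, ⟨h3, h4⟩, h5, h6⟩, h7, h8⟩, rfl⟩
    dsimp only at h1 h2 h3 h4 h5 h6 h7 h8
    rw [List.isChain_append] at h1
    refine ⟨⟨⟨?_, ?_⟩, ⟨?_, ?_⟩, ?_, ?_⟩, by simp⟩
    · rw [List.isChain_append, List.isChain_cons]
      refine ⟨h1.1, ⟨?_, h1.2.1⟩, ?_⟩
      · intro y hy hb
        rw [h7 y hy] at hb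
        simp at hb
      · intro x hx y hy _
        simp only [List.head?_cons, Option.mem_def, Option.some_inj] at hy
        subst hy
        exact h4 x (List.mem_append_left _ (List.mem_of_mem_getLast? hx))
    · rcases a with _ | ⟨x, a⟩
      · intro y hy
        simp only [List.nil_append, List.head?_cons, Option.mem_def, Option.some_inj] at hy
        subst hy
        by_contra hb
        exact h8 (by simpa using hb) rfl
      · exact h2
    · rw [hnd]
      exact ⟨h3, fun y hy => (h4 y hy).ne'⟩
    · intro y hy
      simp only [List.mem_append, List.mem_cons] at hy
      rcases hy with hy | rfl | hy
      · exact (Nat.zero_lt_one.trans (h4 y (List.mem_append_left _ hy)))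
      · exact Nat.zero_lt_one
      · exact (Nat.zero_lt_one.trans (h4 y (List.mem_append_right _ hy)))
    · rw [hcount, h5]
    · rw [hsum]
      push_cast
      rw [h6]

/-- The gap 1 is absent (1 way), marked (`t + 1` places among `t + 1` blocks) or unmarked (`t + 1`
places among `t` blocks). The first two cases share the same shifted count, which gives `t + 2`. -/
theorem encard_arrangements_succ (t : ℕ) (n : ℤ) :
    (arrangements 0 (t + 1) n).encard =
      (t + 2 : ℕ) * (arrangements 0 (t + 1) (n - t - 1)).encard +
        (t + 1 : ℕ) * (arrangements 0 t (n - t - 1)).encard := by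
  have h1 := encard_arrangements_one_mem true (t + 1) n
  have h2 := encard_arrangements_one_mem false t (n - 1)
  rw [encard_splittings, encard_arrangements_one] at h1 h2
  simp only [if_true, add_zero, Bool.false_eq_true, if_false, sub_add_cancel] at h1 h2
  have hnotboth : ∀ v ∈ arrangements 0 (t + 1) n, (1, true) ∈ v → (1, false) ∉ v := by
    intro v hv h h'
    have := List.inj_on_of_nodup_map hv.2.1.1 h h' rfl
    simp at this
  have hsplit : arrangements 0 (t + 1) n = arrangements 1 (t + 1) n ∪
      ({v ∈ arrangements 0 (t + 1) n | (1, true) ∈ v} ∪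
        {v ∈ arrangements 0 (t + 1) n | (1, false) ∈ v}) := by
    ext v
    simp only [Set.mem_union, Set.mem_sep_iff]
    constructor
    · intro hv
      by_cases ht : (1, true) ∈ v
      · exact Or.inr (Or.inl ⟨hv, ht⟩)
      by_cases hf : (1, false) ∈ v
      · exact Or.inr (Or.inr ⟨hv, hf⟩)
      refine Or.inl ⟨hv.1, ⟨hv.2.1.1, fun y hy => ?_⟩, hv.2.2⟩
      have h0 := hv.2.1.2 y hy
      rcases Nat.lt_or_ge 1 y.1 with h | h
      · exact h
      · exfalso
        obtain ⟨e, b⟩ := y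
        obtain rfl : e = 1 := by
          dsimp only at h h0
          omega
        cases b
        · exact hf hy
        · exact ht hy
    · rintro (hv | hv | hv)
      · exact ⟨hv.1, ⟨hv.2.1.1, fun y hy => Nat.zero_lt_one.trans (hv.2.1.2 y hy)⟩, hv.2.2⟩
      · exact hv.1
      · exact hv.1
  rw [hsplit, Set.encard_union_eq, Set.encard_union_eq, h1, h2, encard_arrangements_one,
    show n - 1 - (t : ℤ) = n - t - 1 by ring,
    show n - ((t + 1 : ℕ) : ℤ) = n - t - 1 by push_cast; ring, ← add_assoc]
  · congr 1
    push_cast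
    ring
  · rw [Set.disjoint_left]
    rintro v ⟨hv, h⟩ ⟨-, h'⟩
    exact hnotboth v hv h h'
  · rw [Set.disjoint_left]
    rintro v hv (⟨-, h⟩ | ⟨-, h⟩)
    · exact lt_irrefl _ (hv.2.1.2 _ h)
    · exact lt_irrefl _ (hv.2.1.2 _ h)

/-! ### The matching recursion for weighted tuples. -/

/-- The total weight of the tuples of `t` distinct parts of sum `m`. -/
noncomputable def totalWeight (t : ℕ) (m : ℤ) : ℝ := ∑ p ∈ distinctParts t m, partsWeight p

theorem distinctParts_eq_empty {t : ℕ} {m : ℤ} (hm : m < 0) : distinctParts t m = ∅ := by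
  refine Finset.eq_empty_of_forall_notMem fun p hp => ?_
  have h := (mem_distinctParts.1 hp).2.2
  have : 0 ≤ ∑ i, (p i : ℤ) := Finset.sum_nonneg fun i _ => Int.natCast_nonneg _
  omega

theorem totalWeight_of_neg {t : ℕ} {m : ℤ} (hm : m < 0) : totalWeight t m = 0 := by
  rw [totalWeight, distinctParts_eq_empty hm, Finset.sum_empty]

theorem totalWeight_zero (m : ℤ) : totalWeight 0 m = if m = 0 then 1 else 0 := by
  split_ifs with h
  · have : distinctParts 0 m = {fun i => i.elim0} := by
      ext p
      rw [mem_distinctParts, Finset.mem_singleton]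
      simp only [Subsingleton.strictAnti, IsEmpty.forall_iff, Finset.univ_eq_empty,
        Finset.sum_empty, h, and_self, true_iff]
      exact Subsingleton.elim _ _
    rw [totalWeight, this, Finset.sum_singleton]
    simp [partsWeight]
  · have : distinctParts 0 m = ∅ := by
      refine Finset.eq_empty_of_forall_notMem fun p hp => ?_
      have := (mem_distinctParts.1 hp).2.2
      simp at this
      omega
    rw [totalWeight, this, Finset.sum_empty]

theorem totalWeight_nonneg (t : ℕ) (m : ℤ) : 0 ≤ totalWeight t m :=
  Finset.sum_nonneg fun _ _ => Finset.prod_nonneg fun _ _ => by positivity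

/-- Raising every exponent by one multiplies by ∏ (i+1)/i, which telescopes to `t + 1`. -/
theorem partsWeight_add_one {t : ℕ} (p : Fin t → ℕ) :
    partsWeight (fun i => p i + 1) = (t + 1) * partsWeight p := by
  have h : ∀ t : ℕ, ∏ i : Fin t, (((i : ℕ) + 2 : ℝ) / ((i : ℕ) + 1 : ℝ)) = t + 1 := by
    intro t
    induction t with
    | zero => simp
    | succ t ih =>
      rw [Fin.prod_univ_castSucc]
      simp only [Fin.val_castSucc, Fin.val_last]
      rw [ih]
      push_cast
      field_simp
      ring
  simp only [partsWeight, pow_succ]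
  rw [Finset.prod_mul_distrib, h, mul_comm]

theorem partsWeight_snoc {t : ℕ} (p : Fin t → ℕ) :
    partsWeight (Fin.snoc (fun i => p i + 1) 1 : Fin (t + 1) → ℕ) = (t + 2) * partsWeight p := by
  have h : partsWeight (Fin.snoc (fun i => p i + 1) 1 : Fin (t + 1) → ℕ) =
      partsWeight (fun i => p i + 1) * (((t : ℝ) + 2) / (t + 1)) := by
    unfold partsWeight
    rw [Fin.prod_univ_castSucc]
    simp
  rw [h, partsWeight_add_one]
  field_simp

/-- If the smallest part is not 1, all parts are at least 2, and subtracting 1 from each keeps `t +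
1` positive parts. -/
theorem sum_last_ne_one (t : ℕ) (m : ℤ) :
    ∑ p ∈ distinctParts (t + 1) m with ¬ p (Fin.last t) = 1, partsWeight p =
      (t + 2) * totalWeight (t + 1) (m - t - 1) := by
  rw [totalWeight, Finset.mul_sum]
  refine Finset.sum_nbij' (fun p i => p i - 1) (fun p i => p i + 1) ?_ ?_ ?_ ?_ ?_
  · intro p hp
    rw [Finset.mem_filter, mem_distinctParts] at hp
    obtain ⟨⟨h1, h2, h3⟩, h4⟩ := hp
    have h5 : ∀ i, 2 ≤ p i := by
      intro i
      have := h1.antitone (Fin.le_last i)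
      have := h2 (Fin.last t)
      omega
    rw [mem_distinctParts]
    refine ⟨?_, ?_, ?_⟩
    · intro i j hij
      have := h1 hij
      have := h5 j
      show p j - 1 < p i - 1
      omega
    · intro i
      have := h5 i
      show 1 ≤ p i - 1
      omega
    · have : ∀ i, ((p i - 1 : ℕ) : ℤ) = p i - 1 := fun i => by
        have := h5 i
        omega
      simp only [this, Finset.sum_sub_distrib, h3, Finset.sum_const, Finset.card_univ,
        Fintype.card_fin, nsmul_eq_mul]
      push_cast
      ring
  · intro p hp
    rw [mem_distinctParts] at hp
    obtain ⟨h1, h2, h3⟩ := hp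
    rw [Finset.mem_filter, mem_distinctParts]
    refine ⟨⟨?_, ?_, ?_⟩, ?_⟩
    · intro i j hij
      exact Nat.succ_lt_succ (h1 hij)
    · intro i
      exact Nat.succ_le_succ (Nat.zero_le _)
    · push_cast
      rw [Finset.sum_add_distrib, h3]
      simp
    · have := h2 (Fin.last t)
      show ¬ p (Fin.last t) + 1 = 1
      omega
  · intro p hp
    rw [Finset.mem_filter, mem_distinctParts] at hp
    funext i
    have := hp.1.2.1 i
    show p i - 1 + 1 = p i
    omega
  · intro p _
    funext i
    rfl
  · intro p hp
    rw [Finset.mem_filter, mem_distinctParts] at hp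
    have h := partsWeight_add_one fun i => p i - 1
    have h' : (fun i => p i - 1 + 1) = p := by
      funext i
      have := hp.1.2.1 i
      omega
    rw [h'] at h
    rw [h]
    push_cast
    ring

/-- If the smallest part is 1, subtracting 1 from every part makes it vanish and leaves `t` positive
parts. -/
theorem sum_last_eq_one (t : ℕ) (m : ℤ) :
    ∑ p ∈ distinctParts (t + 1) m with p (Fin.last t) = 1, partsWeight p =
      (t + 2) * totalWeight t (m - t - 1) := by
  rw [totalWeight, Finset.mul_sum]
  have key : ∀ p ∈ (distinctParts (t + 1) m).filter (fun p => p (Fin.last t) = 1),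
      (Fin.snoc (fun i => p (Fin.castSucc i) - 1 + 1) 1 : Fin (t + 1) → ℕ) = p := by
    intro p hp
    rw [Finset.mem_filter, mem_distinctParts] at hp
    funext i
    refine Fin.lastCases ?_ (fun j => ?_) i
    · rw [Fin.snoc_last]
      exact hp.2.symm
    · rw [Fin.snoc_castSucc]
      have := hp.1.2.1 (Fin.castSucc j)
      omega
  refine Finset.sum_nbij' (fun p i => p (Fin.castSucc i) - 1)
    (fun p => (Fin.snoc (fun i => p i + 1) 1 : Fin (t + 1) → ℕ)) ?_ ?_ ?_ ?_ ?_
  · intro p hp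
    rw [Finset.mem_filter, mem_distinctParts] at hp
    obtain ⟨⟨h1, h2, h3⟩, h4⟩ := hp
    have h5 : ∀ i : Fin t, 2 ≤ p (Fin.castSucc i) := by
      intro i
      have := h1 (Fin.castSucc_lt_last i)
      omega
    rw [mem_distinctParts]
    refine ⟨?_, ?_, ?_⟩
    · intro i j hij
      have := h1 (Fin.castSucc_lt_castSucc_iff.2 hij)
      have := h5 j
      show p j.castSucc - 1 < p i.castSucc - 1
      omega
    · intro i
      have := h5 i
      show 1 ≤ p i.castSucc - 1
      omega
    · have : ∀ i : Fin t, ((p i.castSucc - 1 : ℕ) : ℤ) = p i.castSucc - 1 := fun i => by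
        have := h5 i
        omega
      rw [Fin.sum_univ_castSucc, h4] at h3
      simp only [this, Finset.sum_sub_distrib, Finset.sum_const, Finset.card_univ,
        Fintype.card_fin, nsmul_eq_mul]
      push_cast at h3
      linarith
  · intro p hp
    rw [mem_distinctParts] at hp
    obtain ⟨h1, h2, h3⟩ := hp
    rw [Finset.mem_filter, mem_distinctParts]
    refine ⟨⟨?_, ?_, ?_⟩, Fin.snoc_last _ _⟩
    · intro i j hij
      revert hij
      refine Fin.lastCases ?_ (fun j => ?_) j
      · refine Fin.lastCases ?_ (fun i => ?_) i
        · intro h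
          exact absurd h (lt_irrefl _)
        · intro _
          rw [Fin.snoc_last, Fin.snoc_castSucc]
          have := h2 i
          omega
      · refine Fin.lastCases ?_ (fun i => ?_) i
        · intro h
          exact absurd h (Fin.castSucc_lt_last j).le.not_gt
        · intro h
          rw [Fin.snoc_castSucc, Fin.snoc_castSucc]
          have := h1 (Fin.castSucc_lt_castSucc_iff.1 h)
          omega
    · intro i
      refine Fin.lastCases ?_ (fun i => ?_) i
      · rw [Fin.snoc_last]
      · rw [Fin.snoc_castSucc]
        omega
    · rw [Fin.sum_univ_castSucc]
      simp only [Fin.snoc_castSucc, Fin.snoc_last]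
      push_cast
      rw [Finset.sum_add_distrib, h3]
      simp only [Finset.sum_const, Finset.card_univ, Fintype.card_fin, nsmul_eq_mul]
      ring
  · exact key
  · intro p _
    funext i
    show (Fin.snoc (fun i => p i + 1) 1 : Fin (t + 1) → ℕ) i.castSucc - 1 = p i
    rw [Fin.snoc_castSucc]
    omega
  · intro p hp
    rw [← partsWeight_snoc, key p hp]

theorem totalWeight_succ (t : ℕ) (m : ℤ) :
    totalWeight (t + 1) m =
      (t + 2) * (totalWeight (t + 1) (m - t - 1) + totalWeight t (m - t - 1)) := by
  rw [mul_add, ← sum_last_ne_one, ← sum_last_eq_one]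
  exact (Finset.sum_filter_not_add_sum_filter _ _ _).symm

/-- Both sides obey the same recursion once the count is multiplied by `t + 1`. Producing a natural
number also yields finiteness. -/
theorem exists_encard_arrangements_eq (t : ℕ) (m : ℤ) :
    ∃ a : ℕ, (arrangements 0 t m).encard = a ∧ ((t : ℝ) + 1) * a = totalWeight t m := by
  induction t generalizing m with
  | zero =>
    rw [arrangements_zero, totalWeight_zero]
    split_ifs
    · exact ⟨1, by simp, by simp⟩
    · exact ⟨0, by simp, by simp⟩
  | succ t ih =>
    -- The recursion keeps `t + 1` in one of its terms but lowers `m`, so an inner induction on a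
    -- bound for `m` is needed; both sides vanish for negative `m`.
    have key : ∀ (N : ℕ) (m : ℤ), m < N → ∃ a : ℕ, (arrangements 0 (t + 1) m).encard = a ∧
        (((t + 1 : ℕ) : ℝ) + 1) * a = totalWeight (t + 1) m := by
      intro N
      induction N with
      | zero =>
        intro m hm
        refine ⟨0, ?_, ?_⟩
        · have : arrangements 0 (t + 1) m = ∅ := by
            refine Set.eq_empty_of_forall_notMem fun v hv => ?_
            have := hv.2.2.2
            simp only [Nat.cast_zero] at hm
            omega
          simp [this]
        · rw [totalWeight_of_neg (by exact_mod_cast hm)]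
          simp
      | succ N ihN =>
        intro m hm
        obtain ⟨a, ha, ha'⟩ := ihN (m - t - 1) (by push_cast at hm; omega)
        obtain ⟨b, hb, hb'⟩ := ih (m - t - 1)
        refine ⟨(t + 2) * a + (t + 1) * b, ?_, ?_⟩
        · rw [encard_arrangements_succ, ha, hb]
          push_cast
          rfl
        · rw [totalWeight_succ, ← ha', ← hb']
          push_cast
          ring
    exact key (m.toNat + 1) m (by push_cast; omega)

/-! ### The exact formulas for B(n). -/

/-- The arrangements of distinct positive gaps in which the unmarked gaps, each counted with an
extra beat, add up to `n`. -/
def timedArrangements (n : ℕ) : Set (List (ℕ × Bool)) :=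
  {v | (List.IsChain MarkDescends v ∧ FreeHead v) ∧ ((v.map Prod.fst).Nodup ∧ ∀ y ∈ v, 0 < y.1) ∧
    freeSum v + freeCount v = n}

theorem encard_timedArrangements (n : ℕ) :
    (timedArrangements n).encard =
      ∑ t ∈ Finset.range (n + 1), (arrangements 0 t ((n : ℤ) - t)).encard := by
  have h : timedArrangements n =
      ⋃ t ∈ ((Finset.range (n + 1) : Finset ℕ) : Set ℕ), arrangements 0 t ((n : ℤ) - t) := by
    ext v
    simp only [Set.mem_iUnion, Finset.mem_coe, Finset.mem_range, exists_prop]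
    constructor
    · rintro ⟨h1, h2, h3⟩
      exact ⟨freeCount v, by omega, h1, h2, rfl, by omega⟩
    · rintro ⟨t, -, h1, h2, h3, h4⟩
      exact ⟨h1, h2, by omega⟩
  rw [h, Set.Finite.encard_biUnion (Finset.finite_toSet _), finsum_mem_coe_finset]
  intro s _ t _ hst
  rw [Function.onFun, Set.disjoint_left]
  intro v hv hv'
  exact hst (hv.2.2.1.symm.trans hv'.2.2.1)

theorem append_mem_codes {v : List (ℕ × Bool)} {b : Bool} {n : ℕ} :
    v ++ [(0, b)] ∈ codes n ↔ (b = true → v ≠ []) ∧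
      v ∈ {v | (List.IsChain MarkDescends v ∧ FreeHead v) ∧
        ((v.map Prod.fst).Nodup ∧ ∀ y ∈ v, 0 < y.1) ∧
        freeSum v + freeCount v + (if b then 0 else 1) = n} := by
  have hlen : List.IsChain MarkDescends ((0, false) :: (v ++ [(0, b)])) →
      (expand 0 (v ++ [(0, b)])).length =
        freeSum v + freeCount v + (if b then 0 else 1) := by
    intro h
    have h1 := length_expand h
    have h2 : ∀ v : List (ℕ × Bool),
        (v.map fun y => (if y.2 then 0 else y.1 + 1 : ℕ)).sum = freeSum v + freeCount v := by
      intro v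
      induction v with
      | nil => rfl
      | cons y v ih =>
        rw [List.map_cons, List.sum_cons, ih, freeSum_cons, freeCount_cons]
        split_ifs
        · simp
        · ring
    rw [h2, freeSum_append, freeCount_append] at h1
    simp [freeSum, freeCount] at h1
    simp only [freeSum, freeCount]
    rw [h1]
    cases b <;> simp; ring
  have hnd : ((v ++ [(0, b)]).map Prod.fst).Nodup ↔
      (v.map Prod.fst).Nodup ∧ ∀ y ∈ v, 0 < y.1 := by
    simp only [List.map_append, List.map_cons, List.map_nil, List.nodup_append, List.mem_map,
      List.mem_singleton]
    constructor
    · rintro ⟨h1, -, h2⟩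
      exact ⟨h1, fun y hy => Nat.pos_of_ne_zero (h2 _ ⟨y, hy, rfl⟩ 0 rfl)⟩
    · rintro ⟨h1, h2⟩
      refine ⟨h1, by simp, ?_⟩
      rintro _ ⟨y, hy, rfl⟩ _ rfl
      exact (h2 y hy).ne'
  -- No gap lies below the initial 0, so the first gap is unmarked. The final 0 may be marked as
  -- soon as a positive gap precedes it.
  have hchain : ∀ (_ : ∀ y ∈ v, 0 < y.1),
      (List.IsChain MarkDescends ((0, false) :: (v ++ [(0, b)])) ↔
        (b = true → v ≠ []) ∧ List.IsChain MarkDescends v ∧ FreeHead v) := by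
    intro hpos
    rw [List.isChain_cons, List.isChain_append]
    rcases v with _ | ⟨y, v⟩
    · cases b <;> simp [MarkDescends, FreeHead]
    · have hlast : ∀ x ∈ (y :: v).getLast?, ∀ z ∈ [((0 : ℕ), b)].head?, MarkDescends x z := by
        intro x hx z hz _
        simp only [List.head?_cons, Option.mem_def, Option.some_inj] at hz
        subst hz
        exact hpos x (List.mem_of_mem_getLast? hx)
      rw [and_iff_left hlast]
      simp [FreeHead, MarkDescends, and_comm]
  constructor
  · rintro ⟨h1, h2, -, h3⟩
    rw [hnd] at h2
    have h4 := (hchain h2.2).1 h1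
    exact ⟨h4.1, h4.2, h2, by rw [← hlen h1, h3]⟩
  · rintro ⟨h1, h2, h3, h4⟩
    have h5 := (hchain h3.2).2 ⟨h1, h2⟩
    exact ⟨h5, hnd.2 h3, ⟨v, b, rfl⟩, by rw [hlen h5, h4]⟩

/-- A marked return to gap 0 adds nothing to the length, an unmarked one adds one beat. For `n ≥ 1`
the empty arrangement never meets a marked return. -/
theorem encard_codes {n : ℕ} (hn : 1 ≤ n) :
    (codes n).encard = (timedArrangements n).encard + (timedArrangements (n - 1)).encard := by
  have h : codes n = (fun v => v ++ [(0, true)]) '' timedArrangements n ∪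
      (fun v => v ++ [(0, false)]) '' timedArrangements (n - 1) := by
    ext w
    constructor
    · intro hw
      obtain ⟨v, b, rfl⟩ := hw.2.2.1
      obtain ⟨-, h2, h3, h4⟩ := append_mem_codes.1 hw
      cases b
      · refine Or.inr ⟨v, ⟨h2, h3, ?_⟩, rfl⟩
        simp at h4
        omega
      · exact Or.inl ⟨v, ⟨h2, h3, by simpa using h4⟩, rfl⟩
    · rintro (⟨v, ⟨h2, h3, h4⟩, rfl⟩ | ⟨v, ⟨h2, h3, h4⟩, rfl⟩)
      · refine append_mem_codes.2 ⟨?_, h2, h3, by simpa using h4⟩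
        rintro - rfl
        simp [freeSum, freeCount] at h4
        omega
      · refine append_mem_codes.2 ⟨by simp, h2, h3, ?_⟩
        simp
        omega
  rw [h, Set.encard_union_eq, (List.append_left_injective _).encard_image,
    (List.append_left_injective _).encard_image]
  rw [Set.disjoint_left]
  rintro _ ⟨v, -, rfl⟩ ⟨v', -, h⟩
  have := congrArg List.getLast? h
  simp at this

theorem exists_encard_timedArrangements_eq (n : ℕ) :
    ∃ a : ℕ, (timedArrangements n).encard = a ∧
      (a : ℝ) = ∑ t ∈ Finset.range (n + 1), 1 / ((t : ℝ) + 1) * totalWeight t ((n : ℤ) - t) := by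
  choose f hf hf' using exists_encard_arrangements_eq
  refine ⟨∑ t ∈ Finset.range (n + 1), f t ((n : ℤ) - t), ?_, ?_⟩
  · rw [encard_timedArrangements, Nat.cast_sum]
    exact Finset.sum_congr rfl fun t _ => hf _ _
  · rw [Nat.cast_sum]
    refine Finset.sum_congr rfl fun t _ => ?_
    rw [← hf']
    field_simp

theorem tsum_eq_sum_totalWeight (n : ℕ) :
    (∑' t : ℕ, ∑ p ∈ distinctParts t ((n : ℤ) - t), 1 / ((t : ℝ) + 1) * partsWeight p) =
      ∑ t ∈ Finset.range (n + 1), 1 / ((t : ℝ) + 1) * totalWeight t ((n : ℤ) - t) := by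
  rw [tsum_eq_sum (s := Finset.range (n + 1))]
  · simp only [totalWeight, Finset.mul_sum]
  · intro t ht
    rw [Finset.mem_range] at ht
    rw [distinctParts_eq_empty (by omega), Finset.sum_empty]

theorem finite_basePatterns_and_B_eq {n : ℕ} (hn : 1 ≤ n) :
    (basePatterns n).Finite ∧ (B n : ℝ) =
      (∑' t : ℕ, ∑ p ∈ distinctParts t ((n : ℤ) - t), 1 / ((t : ℝ) + 1) * partsWeight p) +
        ∑' t : ℕ, ∑ p ∈ distinctParts t ((n : ℤ) - t - 1),
          1 / ((t : ℝ) + 1) * partsWeight p := by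
  obtain ⟨a, ha, ha'⟩ := exists_encard_timedArrangements_eq n
  obtain ⟨b, hb, hb'⟩ := exists_encard_timedArrangements_eq (n - 1)
  have h : (basePatterns n).encard = (a + b : ℕ) := by
    rw [← (bijOn_expand n).image_eq, (bijOn_expand n).injOn.encard_image, encard_codes hn, ha, hb]
    push_cast
    rfl
  refine ⟨Set.finite_of_encard_eq_coe h, ?_⟩
  rw [B, Set.ncard, h, ENat.toNat_natCast, tsum_eq_sum_totalWeight, ← ha']
  have h1 := tsum_eq_sum_totalWeight (n - 1)
  rw [← hb', Nat.cast_sub hn] at h1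
  push_cast at h1 ⊢
  rw [← h1]
  congr 1
  refine tsum_congr fun t => ?_
  rw [sub_right_comm]

theorem B_eq_tsum_c {n : ℕ} (hn : 2 ≤ n) :
    (B n : ℝ) = (∑' t : ℕ+, ((t : ℕ) : ℝ) * c t ((n : ℤ) - (t : ℕ))) +
      ∑' t : ℕ+, ((t : ℕ) : ℝ) * c t ((n : ℤ) - (t : ℕ) - 1) := by
  have hc : ∀ (t : ℕ) (m : ℤ), 0 < t →
      (t : ℝ) * c t m = ∑ p ∈ distinctParts t m, 1 / ((t : ℝ) + 1) * partsWeight p := by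
    intro t m ht
    rw [c, Finset.mul_sum]
    refine Finset.sum_congr rfl fun p _ => ?_
    field_simp
  have key : ∀ g : ℕ → ℝ, g 0 = 0 → ∑' t : ℕ, g t = ∑' t : ℕ+, g t := by
    intro g hg
    refine (tsum_subtype_eq_of_support_subset (s := {n : ℕ | 0 < n}) fun t ht => ?_).symm
    rcases Nat.eq_zero_or_pos t with rfl | h
    · exact absurd hg ht
    · exact h
  have h0 : ∀ m : ℤ, m ≠ 0 →
      ∑ p ∈ distinctParts 0 m, 1 / (((0 : ℕ) : ℝ) + 1) * partsWeight p = 0 := by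
    intro m hm
    rw [← Finset.mul_sum]
    have := totalWeight_zero m
    rw [if_neg hm] at this
    rw [totalWeight] at this
    rw [this, mul_zero]
  -- The `t = 0` terms live at `n = 0` and `n = 1` respectively, so both vanish for `n ≥ 2`.
  rw [(finite_basePatterns_and_B_eq (by omega)).2, key _ (h0 _ (by push_cast; omega)),
    key _ (h0 _ (by push_cast; omega))]
  simp only [hc _ _ (PNat.pos _)]

/-! ### Asymptotics. -/

open Filter Topology

theorem two_pow_sub_pos (t : ℕ) : (0 : ℝ) < 2 ^ (t + 2) - ((t : ℝ) + 2) - 1 := by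
  have h : ((t + 3 : ℕ) : ℝ) < 2 ^ (t + 2) := by
    have : t + 3 < 2 ^ (t + 2) := by
      induction t with
      | zero => norm_num
      | succ t ih =>
        rw [show t + 1 + 2 = (t + 2) + 1 by ring, pow_succ]
        omega
    exact_mod_cast this
  push_cast at h
  linarith

theorem q_pos {t : ℕ} (ht : 1 ≤ t) : 0 < q t := by
  induction t, ht using Nat.le_induction with
  | base => norm_num [q]
  | succ t ht ih =>
    obtain ⟨s, rfl⟩ := Nat.exists_eq_add_of_le' ht
    rw [q]
    exact mul_pos (div_pos (by positivity) (two_pow_sub_pos s)) ih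

theorem q_nonneg (t : ℕ) : 0 ≤ q t := by
  rcases Nat.eq_zero_or_pos t with rfl | h
  · exact le_rfl
  · exact (q_pos h).le

/-- This is the fixed-point form of the recursion `cRatio_succ`, with all dependence on `m` dropped.
-/
theorem two_pow_mul_q_succ {t : ℕ} (ht : 1 ≤ t) :
    2 ^ (t + 1) * q (t + 1) = ((t : ℝ) + 2) * q (t + 1) + t * q t := by
  obtain ⟨s, rfl⟩ := Nat.exists_eq_add_of_le' ht
  have h := (two_pow_sub_pos s).ne'
  have h1 : (2 ^ (s + 2) - ((s : ℝ) + 2) - 1) * q (s + 2) = ((s : ℝ) + 1) * q (s + 1) := by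
    rw [q]
    field_simp
  push_cast
  rw [show s + 1 + 1 = s + 2 by ring]
  linarith

theorem q_le_half (t : ℕ) : q t ≤ 1 / 2 := by
  rcases Nat.eq_zero_or_pos t with rfl | h
  · norm_num [q]
  induction t, h using Nat.le_induction with
  | base => norm_num [q]
  | succ t ht ih =>
    obtain ⟨s, rfl⟩ := Nat.exists_eq_add_of_le' ht
    rw [q]
    refine (mul_le_of_le_one_left (q_nonneg _) ?_).trans ih
    rw [div_le_one (two_pow_sub_pos s)]
    have h : ((2 * s + 4 : ℕ) : ℝ) ≤ 2 ^ (s + 2) := by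
      have : 2 * s + 4 ≤ 2 ^ (s + 2) := by
        clear ih
        clear ht
        induction s with
        | zero => norm_num
        | succ s ih =>
          rw [show s + 1 + 2 = (s + 2) + 1 by ring, pow_succ]
          omega
      exact_mod_cast this
    push_cast at h
    linarith

/-- The ratio of `c t m` to `2 ^ m`. -/
noncomputable def cRatio (t : ℕ) (m : ℤ) : ℝ := c t m / 2 ^ m

theorem c_eq_totalWeight (t : ℕ) (m : ℤ) :
    c t m = 1 / ((t : ℝ) * ((t : ℝ) + 1)) * totalWeight t m := by
  rw [c, totalWeight, Finset.mul_sum]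

theorem cRatio_nonneg (t : ℕ) (m : ℤ) : 0 ≤ cRatio t m := by
  rw [cRatio, c_eq_totalWeight]
  exact div_nonneg (mul_nonneg (by positivity) (totalWeight_nonneg _ _)) (by positivity)

theorem cRatio_of_neg {t : ℕ} {m : ℤ} (hm : m < 0) : cRatio t m = 0 := by
  rw [cRatio, c_eq_totalWeight, totalWeight_of_neg hm]
  simp

theorem cRatio_succ {t : ℕ} (ht : 1 ≤ t) (m : ℤ) :
    2 ^ (t + 1) * cRatio (t + 1) m =
      ((t : ℝ) + 2) * cRatio (t + 1) (m - (t + 1)) + t * cRatio t (m - (t + 1)) := by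
  have hpow : (2 : ℝ) ^ m = 2 ^ (m - (t + 1)) * 2 ^ (t + 1) := by
    rw [← zpow_natCast (2 : ℝ) (t + 1), ← zpow_add₀ two_ne_zero]
    congr 1
    push_cast
    ring
  have ht' : (t : ℝ) ≠ 0 := by positivity
  simp only [cRatio, c_eq_totalWeight]
  rw [totalWeight_succ, hpow, show m - t - 1 = m - (t + 1) by ring]
  push_cast
  have h1 : (t : ℝ) + 1 + 1 ≠ 0 := by positivity
  have h2 : (2 : ℝ) ^ (m - (t + 1)) ≠ 0 := by positivity
  field_simp
  ring

theorem cRatio_one (m : ℤ) : cRatio 1 m = if 1 ≤ m then 1 / 2 else 0 := by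
  have key : ∀ (N : ℕ) (m : ℤ), m < N → cRatio 1 m = if 1 ≤ m then 1 / 2 else 0 := by
    intro N
    induction N with
    | zero =>
      intro m hm
      rw [Nat.cast_zero] at hm
      rw [cRatio_of_neg hm, if_neg (by omega)]
    | succ N ih =>
      intro m hm
      have hrec : cRatio 1 m = cRatio 1 (m - 1) + if m = 1 then 1 / 2 else 0 := by
        have hpow : (2 : ℝ) ^ m = 2 ^ (m - 1) * 2 := by
          rw [← zpow_add_one₀ two_ne_zero, sub_add_cancel]
        simp only [cRatio, c_eq_totalWeight]
        have := totalWeight_succ 0 m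
        simp only [zero_add, Nat.cast_zero, sub_zero] at this
        rw [this, totalWeight_zero, hpow]
        have h2 : (2 : ℝ) ^ (m - 1) ≠ 0 := by positivity
        rcases eq_or_ne m 1 with rfl | hm1
        · norm_num
          ring
        · rw [if_neg (by omega), if_neg hm1]
          field_simp
          norm_num
      rw [hrec, ih (m - 1) (by push_cast at hm; omega)]
      split_ifs <;> first | omega | norm_num
  exact key (m.toNat + 1) m (by push_cast; omega)

/-- The recursion has nonnegative coefficients, so monotonicity and the bound by the fixed point
propagate from smaller `m` and from `t`. The limit then exists and must solve the fixed-point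
equation. -/
theorem cRatio_spec {t : ℕ} (ht : 1 ≤ t) :
    Monotone (cRatio t) ∧ (∀ m, cRatio t m ≤ q t) ∧ Tendsto (cRatio t) atTop (𝓝 (q t)) := by
  induction t, ht using Nat.le_induction with
  | base =>
    refine ⟨?_, ?_, ?_⟩
    · intro m n hmn
      rw [cRatio_one, cRatio_one]
      split_ifs <;> first | omega | norm_num
    · intro m
      rw [cRatio_one]
      split_ifs <;> norm_num [q]
    · refine tendsto_const_nhds.congr' ?_
      filter_upwards [eventually_ge_atTop 1] with m hm
      rw [cRatio_one, if_pos hm, q]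
  | succ t ht ih =>
    obtain ⟨hmono, hle, hlim⟩ := ih
    have hpow : (0 : ℝ) < 2 ^ (t + 1) := by positivity
    have hmono' : Monotone (cRatio (t + 1)) := by
      refine monotone_int_of_le_succ ?_
      have key : ∀ (N : ℕ) (m : ℤ), m < N → cRatio (t + 1) m ≤ cRatio (t + 1) (m + 1) := by
        intro N
        induction N with
        | zero =>
          intro m hm
          rw [Nat.cast_zero] at hm
          rw [cRatio_of_neg hm]
          exact cRatio_nonneg _ _
        | succ N ihN =>
          intro m hm
          refine le_of_mul_le_mul_left ?_ hpow
          rw [cRatio_succ ht, cRatio_succ ht]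
          have h1 := ihN (m - (t + 1)) (by push_cast at hm; omega)
          rw [show m - ((t : ℤ) + 1) + 1 = m + 1 - (t + 1) by ring] at h1
          have h2 := hmono (show m - ((t : ℤ) + 1) ≤ m + 1 - (t + 1) by omega)
          gcongr
      intro m
      exact key (m.toNat + 1) m (by push_cast; omega)
    have hle' : ∀ m, cRatio (t + 1) m ≤ q (t + 1) := by
      have key : ∀ (N : ℕ) (m : ℤ), m < N → cRatio (t + 1) m ≤ q (t + 1) := by
        intro N
        induction N with
        | zero =>
          intro m hm
          rw [Nat.cast_zero] at hm
          rw [cRatio_of_neg hm]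
          exact q_nonneg _
        | succ N ihN =>
          intro m hm
          refine le_of_mul_le_mul_left ?_ hpow
          rw [cRatio_succ ht, two_pow_mul_q_succ ht]
          have h1 := ihN (m - (t + 1)) (by push_cast at hm; omega)
          have h2 := hle (m - (t + 1))
          gcongr
      intro m
      exact key (m.toNat + 1) m (by push_cast; omega)
    refine ⟨hmono', hle', ?_⟩
    have hconv := tendsto_atTop_ciSup hmono' ⟨q (t + 1), by rintro _ ⟨m, rfl⟩; exact hle' m⟩
    set L := ⨆ m, cRatio (t + 1) m
    have hshift : Tendsto (fun m : ℤ => m - ((t : ℤ) + 1)) atTop atTop :=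
      tendsto_atTop_add_const_right _ _ tendsto_id
    have hL : 2 ^ (t + 1) * L = ((t : ℝ) + 2) * L + t * q t := by
      refine tendsto_nhds_unique (hconv.const_mul _) ?_
      simp only [cRatio_succ ht]
      exact ((hconv.comp hshift).const_mul _).add ((hlim.comp hshift).const_mul _)
    have hq := two_pow_mul_q_succ ht
    have hpos : (0 : ℝ) < 2 ^ (t + 1) - (t + 2) := by
      obtain ⟨s, rfl⟩ := Nat.exists_eq_add_of_le' ht
      have := two_pow_sub_pos s
      push_cast
      rw [show s + 1 + 1 = s + 2 by ring]
      linarith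
    -- The fixed-point equation determines `L` because its coefficient `2 ^ (t + 1) - (t + 2)` is
    -- nonzero.
    have : L = q (t + 1) := by
      refine mul_left_cancel₀ hpos.ne' ?_
      linarith
    rwa [← this]

theorem summable_q : Summable fun t : ℕ+ => ((t : ℕ) : ℝ) * q t / 2 ^ (t : ℕ) := by
  have h : Summable fun t : ℕ => (t : ℝ) * q t / 2 ^ t := by
    have hg : Summable fun t : ℕ => (t : ℝ) ^ 1 * (1 / 2) ^ t :=
      summable_pow_mul_geometric_of_norm_lt_one 1 (by norm_num)
    refine Summable.of_nonneg_of_le (fun t => ?_) (fun t => ?_) hg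
    · have := q_nonneg t
      positivity
    · rw [pow_one, one_div_pow, mul_one_div]
      have := q_le_half t
      gcongr
      exact mul_le_of_le_one_right (Nat.cast_nonneg _) (by linarith)
  exact h.comp_injective PNat.coe_injective

theorem q_eq_prod {t : ℕ} (ht : 1 ≤ t) :
    q t = 1 / 2 * ∏ i ∈ Finset.Icc 2 t, ((i : ℝ) - 1) / ((2 : ℝ) ^ i - (i : ℝ) - 1) := by
  induction t, ht using Nat.le_induction with
  | base => simp [q]
  | succ t ht ih =>
    rw [Finset.prod_Icc_succ_top (by omega)]
    obtain ⟨s, rfl⟩ := Nat.exists_eq_add_of_le' ht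
    rw [q, ih]
    push_cast
    rw [show s + 1 + 1 = s + 2 by ring]
    ring

theorem gammaB_eq :
    gammaB = 3 / 4 * ∑' t : ℕ+, ((t : ℕ) : ℝ) *
      (1 / 2 ^ (t : ℕ) *
        ∏ i ∈ Finset.Icc 2 (t : ℕ), ((i : ℝ) - 1) / ((2 : ℝ) ^ i - (i : ℝ) - 1)) := by
  rw [gammaB, ← tsum_mul_left, ← tsum_mul_left]
  refine tsum_congr fun t => ?_
  rw [q_eq_prod t.pos]
  ring

theorem gammaB_pos : 0 < gammaB := by
  refine mul_pos (by norm_num) (summable_q.tsum_pos (fun t => ?_) 1 ?_)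
  · have := q_nonneg t
    positivity
  · have := q_pos (t := ((1 : ℕ+) : ℕ)) le_rfl
    positivity

/-- The sum `∑ t c_t(n - t - k)` is asymptotic to `2 ^ (n - k) ∑ t q_t / 2 ^ t`. -/
theorem tendsto_tsum_c_div (k : ℕ) :
    Tendsto (fun n : ℕ => (∑' t : ℕ+, ((t : ℕ) : ℝ) * c t ((n : ℤ) - (t : ℕ) - k)) / 2 ^ n) atTop
      (𝓝 ((1 / 2 ^ k) * ∑' t : ℕ+, ((t : ℕ) : ℝ) * q t / 2 ^ (t : ℕ))) := by
  have hterm : ∀ (n : ℕ) (t : ℕ+), ((t : ℕ) : ℝ) * c t ((n : ℤ) - (t : ℕ) - k) / 2 ^ n =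
      1 / 2 ^ k * (((t : ℕ) : ℝ) * cRatio t ((n : ℤ) - (t : ℕ) - k) / 2 ^ (t : ℕ)) := by
    intro n t
    have hpow : (2 : ℝ) ^ n = 2 ^ ((n : ℤ) - (t : ℕ) - k) * 2 ^ (t : ℕ) * 2 ^ k := by
      rw [← zpow_natCast (2 : ℝ) n, ← zpow_natCast (2 : ℝ) t, ← zpow_natCast (2 : ℝ) k,
        ← zpow_add₀ two_ne_zero, ← zpow_add₀ two_ne_zero]
      congr 1
      ring
    rw [cRatio, hpow]
    field_simp
  simp only [← tsum_div_const, hterm, tsum_mul_left]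
  -- The limit series itself dominates, since `cRatio t` never exceeds `q t`.
  refine Tendsto.const_mul _ (tendsto_tsum_of_dominated_convergence summable_q ?_ ?_)
  · intro t
    have hshift : Tendsto (fun n : ℕ => (n : ℤ) - (t : ℕ) - k) atTop atTop :=
      tendsto_atTop_add_const_right _ _
        (tendsto_atTop_add_const_right _ _ tendsto_natCast_atTop_atTop)
    exact (((cRatio_spec t.pos).2.2.comp hshift).const_mul _).div_const _
  · refine Eventually.of_forall fun n t => ?_
    have h0 := cRatio_nonneg t ((n : ℤ) - (t : ℕ) - k)
    rw [Real.norm_of_nonneg (by positivity)]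
    have := (cRatio_spec t.pos).2.1 ((n : ℤ) - (t : ℕ) - k)
    gcongr

theorem isEquivalent_B :
    Asymptotics.IsEquivalent atTop (fun n : ℕ => (B n : ℝ)) (fun n : ℕ => gammaB * 2 ^ n) := by
  have h : Tendsto (fun n : ℕ => (B n : ℝ) / 2 ^ n) atTop (𝓝 gammaB) := by
    have h1 := (tendsto_tsum_c_div 0).add (tendsto_tsum_c_div 1)
    have hg : (1 / 2 ^ 0) * (∑' t : ℕ+, ((t : ℕ) : ℝ) * q t / 2 ^ (t : ℕ)) +
        (1 / 2 ^ 1) * ∑' t : ℕ+, ((t : ℕ) : ℝ) * q t / 2 ^ (t : ℕ) = gammaB := by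
      rw [gammaB]
      ring
    rw [hg] at h1
    refine h1.congr' ?_
    filter_upwards [eventually_ge_atTop 2] with n hn
    rw [B_eq_tsum_c hn, add_div]
    simp
  -- Passing from the limit of B(n) / 2^n to a ratio tending to 1 needs `gammaB` to be nonzero.
  refine Asymptotics.isEquivalent_of_tendsto_one ?_
  have h2 := h.div_const gammaB
  rw [div_self gammaB_pos.ne'] at h2
  refine h2.congr fun n => ?_
  rw [Pi.div_apply, div_div, mul_comm gammaB]

end Juggling

theorem mainTheorem10 :
    -- there are finitely many patterns, so that the count `B n` is meaningful
    (∀ n : ℕ, 1 ≤ n → (Juggling.basePatterns n).Finite) ∧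
    -- the count, as an explicit double sum
    (∀ n : ℕ, 1 ≤ n →
      (Juggling.B n : ℝ) =
        (∑' t : ℕ, ∑ p ∈ Juggling.distinctParts t ((n : ℤ) - t),
            1 / ((t : ℝ) + 1) * Juggling.partsWeight p) +
        ∑' t : ℕ, ∑ p ∈ Juggling.distinctParts t ((n : ℤ) - t - 1),
            1 / ((t : ℝ) + 1) * Juggling.partsWeight p) ∧
    -- the count, through `c_t`
    (∀ n : ℕ, 2 ≤ n →
      (Juggling.B n : ℝ) =
        (∑' t : ℕ+, ((t : ℕ) : ℝ) * Juggling.c t ((n : ℤ) - (t : ℕ))) +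
        ∑' t : ℕ+, ((t : ℕ) : ℝ) * Juggling.c t ((n : ℤ) - (t : ℕ) - 1)) ∧
    -- the series for the constant converges, and the constant has a second form
    (Summable fun t : ℕ+ => ((t : ℕ) : ℝ) * Juggling.q t / 2 ^ (t : ℕ)) ∧
    (Juggling.gammaB =
      3 / 4 * ∑' t : ℕ+, ((t : ℕ) : ℝ) *
        (1 / 2 ^ (t : ℕ) *
          ∏ i ∈ Finset.Icc 2 (t : ℕ), ((i : ℝ) - 1) / ((2 : ℝ) ^ i - (i : ℝ) - 1))) ∧
    -- the asymptotics
    Asymptotics.IsEquivalent Filter.atTop (fun n : ℕ => (Juggling.B n : ℝ))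
      (fun n : ℕ => Juggling.gammaB * 2 ^ n) := by
  exact ⟨fun n hn => (Juggling.finite_basePatterns_and_B_eq hn).1,
    fun n hn => (Juggling.finite_basePatterns_and_B_eq hn).2,
    fun n hn => Juggling.B_eq_tsum_c hn, Juggling.summable_q, Juggling.gammaB_eq,
    Juggling.isEquivalent_B⟩
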